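/- Let $n\ge 0$ and $m\ge 1$ be integers. Equip the holomorphic line bundle $\mathcal O(m)$ on $\mathbb{CP}^n$ with the Fubini–Study Hermitian metric, $|s|^2([Z])=|s(Z)|^2/|Z|^{2m}$ (a section $s$ being identified with a function on $\mathbb C^{n+1}\setminus\{0\}$ that is homogeneous of degree $m$), and with the associated Chern connection $\nabla$; in the affine chart $U_i=\{Z_i\neq 0\}$ with the frame $e_i=Z_i^m$ and $s=f e_i$ it is $\nabla s=(df-f\,\partial\varphi)\otimes e_i$, where $\varphi=m\log(1+|z|^2)$. A point $p$ is a critical point of $s\in H^0(\mathbb{CP}^n,\mathcal O(m))$ if $\nabla s(p)=0$; it is non-degenerate if moreover $s(p)\neq 0$ and the real Hessian of $\log|s|^2$ at $p$ is non-degenerate. There is a subset $S$ of Lebesgue measure zero of the finite-dimensional complex vector space $H^0(\mathbb{CP}^n,\mathcal O(m))$ such that for every $s\in H^0(\mathbb{CP}^n,\mathcal O(m))\setminus S$: 1. every critical point of $s$ is non-degenerate and is isolated in the set of critical points of $s$; 2. the function $|s|^2$ on $\mathbb{CP}^n$ is a generalized Morse (Morse–Bott) function: it is smooth, and each connected component $N$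 of its critical set is a non-degenerate critical manifold, i.e. $N$ is a connected embedded smooth submanifold of $\mathbb{CP}^n$ along which $d|s|^2=0$, and the Hessian of $|s|^2$ is non-degenerate on the normal bundle of $N$ (at each $p\in N$ the null space of the Hessian is $T_pN$). -/

import Mathlib

open scoped Topology ContDiff LinearAlgebra.Projectivization

noncomputable section

namespace FubiniStudy

/-! ### Complex projective space and its affine charts -/

/-- Nonzero vectors of `ℂ^{n+1}` (homogeneous coordinates). -/
abbrev Punctured (n : ℕ) : Type := {Z : Fin (n + 1) → ℂ // Z ≠ 0}

/-- Complex projective space `ℂPⁿ`, the lines through the origin of `ℂ^{n+1}`. -/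
abbrev CP (n : ℕ) : Type := ℙ ℂ (Fin (n + 1) → ℂ)

/-- The quotient topology from `ℂ^{n+1} ∖ {0}`. -/
instance instTopologicalSpaceCP (n : ℕ) : TopologicalSpace (CP n) :=
  TopologicalSpace.coinduced (fun Z : Punctured n => Projectivization.mk ℂ Z.1 Z.2) inferInstance

/-- The vector `(z₁, …, 1, …, zₙ)` with the `1` inserted at position `i`. -/
def affineLift {n : ℕ} (i : Fin (n + 1)) (z : Fin n → ℂ) : Punctured n :=
  ⟨i.insertNth (α := fun _ => ℂ) 1 z, fun h => by
    have := congrFun h i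
    simp at this⟩

/-- The inverse of the `i`-th affine chart: `ℂⁿ` is identified with `Uᵢ = {Zᵢ ≠ 0} ⊆ ℂPⁿ`.
These `n + 1` charts form the standard atlas of `ℂPⁿ`. -/
def affinePt {n : ℕ} (i : Fin (n + 1)) (z : Fin n → ℂ) : CP n :=
  Projectivization.mk ℂ (affineLift i z).1 (affineLift i z).2

/-! ### Holomorphic sections of `𝒪(m)` -/

/-- `H⁰(ℂPⁿ, 𝒪(m))`. The fibre of `𝒪(m)` over a line `ℓ` consists of the functions on `ℓ ∖ {0}`
that are homogeneous of degree `m`, so a section is a function on `ℂ^{n+1} ∖ {0}` that is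
homogeneous of degree `m`. Over `Uᵢ` the bundle has the frame `eᵢ = Zᵢ^m`, in which the section
is `z ↦ s (affineLift i z)`; the section is holomorphic if all of these functions are. -/
def H0 (n m : ℕ) : Submodule ℂ (Punctured n → ℂ) where
  carrier := {s | (∀ (c : ℂ) (hc : c ≠ 0) (Z : Punctured n),
      s ⟨c • Z.1, smul_ne_zero hc Z.2⟩ = c ^ m * s Z) ∧
    ∀ i, Differentiable ℂ fun z : Fin n → ℂ => s (affineLift i z)}
  add_mem' := by
    rintro s t ⟨hs, hs'⟩ ⟨ht, ht'⟩
    refine ⟨fun c hc Z => ?_, fun i => (hs' i).add (ht' i)⟩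
    simp only [Pi.add_apply, hs c hc Z, ht c hc Z, mul_add]
  zero_mem' := ⟨fun c hc Z => by simp, fun i => by simp⟩
  smul_mem' := by
    rintro a s ⟨hs, hs'⟩
    refine ⟨fun c hc Z => ?_, fun i => (hs' i).const_mul a⟩
    simp only [Pi.smul_apply, smul_eq_mul, hs c hc Z]
    ring

variable {n m : ℕ}

/-- The local expression `f` of `s = f eᵢ` over `Uᵢ`. -/
def localExpr (s : H0 n m) (i : Fin (n + 1)) (z : Fin n → ℂ) : ℂ := s.1 (affineLift i z)

theorem apply_eq_of_ne_zero (s : H0 n m) (i : Fin (n + 1)) (Z : Punctured n) (h : Z.1 i ≠ 0) :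
    s.1 Z = (Z.1 i) ^ m * localExpr s i (fun k => (Z.1 i)⁻¹ * Z.1 (i.succAbove k)) := by
  have key := s.2.1 (Z.1 i) h (affineLift i (fun k => (Z.1 i)⁻¹ * Z.1 (i.succAbove k)))
  rw [localExpr, ← key]
  refine congrArg s.1 (Subtype.ext ?_)
  funext j
  refine Fin.succAboveCases i ?_ (fun k => ?_) j
  · simp [affineLift]
  · simp [affineLift, h]

/-- An entire function of growth `O(|t|^m)` with `m + 1` zeros `0, …, m` vanishes. -/
theorem entire_eq_zero (m : ℕ) (g : ℂ → ℂ) (hg : Differentiable ℂ g) (C : ℝ)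
    (hC : ∀ t : ℂ, 1 ≤ ‖t‖ → ‖g t‖ ≤ C * ‖t‖ ^ m)
    (h0 : ∀ k : ℕ, k ≤ m → g k = 0) : g = 0 := by
  have hC0 : 0 ≤ C := by
    have := (norm_nonneg _).trans (hC 1 (by simp))
    simpa using this
  have hder : ∀ k, m < k → iteratedDeriv k g 0 = 0 := by
    intro k hk
    have hb : ∀ R : ℝ, 1 ≤ R → ‖iteratedDeriv k g 0‖ ≤ (k.factorial * C) / R := by
      intro R hR
      have hR0 : 0 < R := by linarith
      have := Complex.norm_iteratedDeriv_le_of_forall_mem_sphere_norm_le k hR0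
        (hg.diffContOnCl (s := Metric.ball (0 : ℂ) R)) (C := C * R ^ m) (fun z hz => by
          have hz' : ‖z‖ = R := by simpa using hz
          simpa [hz'] using hC z (by rw [hz']; exact hR))
      refine this.trans ?_
      rw [div_le_div_iff₀ (by positivity) hR0]
      have : R ^ m * R ≤ R ^ k := by
        rw [← pow_succ]
        exact pow_le_pow_right₀ hR hk
      calc (k.factorial : ℝ) * (C * R ^ m) * R = k.factorial * C * (R ^ m * R) := by ring
        _ ≤ k.factorial * C * R ^ k := by gcongr
    have hlim : Filter.Tendsto (fun R : ℝ => (k.factorial * C) / R) Filter.atTop (𝓝 0) :=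
      tendsto_const_nhds.div_atTop Filter.tendsto_id
    have hle : ‖iteratedDeriv k g 0‖ ≤ 0 := ge_of_tendsto hlim
      (Filter.eventually_atTop.2 ⟨1, fun R hR => hb R hR⟩)
    exact norm_le_zero_iff.1 hle
  let P : Polynomial ℂ := ∑ k ∈ Finset.range (m + 1),
    Polynomial.monomial k ((k.factorial : ℂ)⁻¹ * iteratedDeriv k g 0)
  have hP : ∀ t, g t = P.eval t := by
    intro t
    have h1 := Complex.taylorSeries_eq_of_entire' (c := 0) (z := t) hg
    rw [← h1, tsum_eq_sum (s := Finset.range (m + 1))]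
    · simp [P, Polynomial.eval_finsetSum]
    · intro k hk
      simp [hder k (by simpa using hk)]
  have hdeg : P.natDegree < m + 1 := by
    refine Nat.lt_succ_of_le (Polynomial.natDegree_sum_le_of_forall_le _ _ fun k hk => ?_)
    exact (Polynomial.natDegree_monomial_le _).trans (Nat.lt_succ_iff.1 (Finset.mem_range.1 hk))
  have hP0 : P = 0 := by
    refine Polynomial.eq_zero_of_natDegree_lt_card_of_eval_eq_zero P
      (f := fun k : Fin (m + 1) => ((k : ℕ) : ℂ)) ?_ ?_ (by simpa using hdeg)
    · intro a b hab
      exact Fin.ext (by simpa using hab)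
    · intro k
      rw [← hP]
      exact h0 k (Nat.lt_succ_iff.1 k.2)
  funext t
  simp [hP, hP0]

theorem localExpr_line_bound (s : H0 n m) (z : Fin n → ℂ) (j : Fin n) :
    ∃ C : ℝ, ∀ t : ℂ, 1 ≤ ‖t‖ → ‖localExpr s 0 (Function.update z j t)‖ ≤ C * ‖t‖ ^ m := by
  let Y : Fin (n + 1) → ℂ := (affineLift 0 (Function.update z j 0)).1
  have hcont : Continuous fun u : ℂ =>
      localExpr s j.succ (fun k => u * Y (j.succ.succAbove k)) :=
    (s.2.2 j.succ).continuous.comp (by fun_prop)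
  obtain ⟨C, hC⟩ := (isCompact_closedBall (0 : ℂ) 1).exists_bound_of_continuousOn
    hcont.continuousOn
  refine ⟨C, fun t ht => ?_⟩
  have ht0 : t ≠ 0 := fun h => by simp [h] at ht; linarith
  have hj : (affineLift 0 (Function.update z j t)).1 j.succ = t := by simp [affineLift]
  have h1 := apply_eq_of_ne_zero s j.succ (affineLift 0 (Function.update z j t))
    (by rw [hj]; exact ht0)
  have h2 : ∀ k, (affineLift 0 (Function.update z j t)).1 (j.succ.succAbove k)
      = Y (j.succ.succAbove k) := by
    intro k
    have hne := Fin.succAbove_ne j.succ k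
    generalize j.succ.succAbove k = l at hne
    refine Fin.cases ?_ (fun l' hne => ?_) l hne
    · intro _; rfl
    · have : l' ≠ j := fun h => hne (by rw [h])
      simp [Y, affineLift, this]
  simp only [hj, h2] at h1
  rw [localExpr, h1, norm_mul, norm_pow, mul_comm]
  gcongr
  apply hC
  rw [mem_closedBall_zero_iff, norm_inv]
  exact inv_le_one_of_one_le₀ ht

/-- `H⁰(ℂPⁿ, 𝒪(m))` is finite-dimensional, so that it carries a Lebesgue measure. -/
instance instFiniteDimensionalH0 (n m : ℕ) : FiniteDimensional ℂ (H0 n m) := by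
  let L : H0 n m →ₗ[ℂ] ((Fin n → Fin (m + 1)) → ℂ) :=
    { toFun := fun s a => localExpr s 0 (fun j => ((a j : ℕ) : ℂ))
      map_add' := fun s t => rfl
      map_smul' := fun c s => rfl }
  refine FiniteDimensional.of_injective L ((injective_iff_map_eq_zero L).2 fun s hs => ?_)
  have hgrid : ∀ A : Finset (Fin n), ∀ z : Fin n → ℂ,
      (∀ j, j ∉ A → ∃ k : ℕ, k ≤ m ∧ z j = k) → localExpr s 0 z = 0 := by
    intro A
    induction A using Finset.induction_on with
    | empty =>
      intro z hz
      choose a ha ha' using fun j => hz j (by simp)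
      have := congrFun hs (fun j => ⟨a j, Nat.lt_succ_of_le (ha j)⟩)
      have hz' : z = fun j => ((a j : ℕ) : ℂ) := funext ha'
      rw [hz']
      exact this
    | insert b A hb ih =>
      intro z hz
      obtain ⟨C, hC⟩ := localExpr_line_bound s z b
      have hd : Differentiable ℂ fun t : ℂ => localExpr s 0 (Function.update z b t) := by
        refine (s.2.2 0).comp (differentiable_pi.2 fun j => ?_)
        by_cases h : j = b
        · subst h; simp
        · simp [h]
      have := entire_eq_zero m _ hd C hC (fun k hk => ih _ fun j hj => by
        by_cases h : j = b
        · subst h; exact ⟨k, hk, by simp⟩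
        · simpa [h] using hz j (by simp [h, hj]))
      simpa using congrFun this (z b)
  have h0 : ∀ z, localExpr s 0 z = 0 := fun z => hgrid Finset.univ z (by simp)
  have h0' : ∀ Z : Punctured n, Z.1 0 ≠ 0 → s.1 Z = 0 := fun Z hZ => by
    rw [apply_eq_of_ne_zero s 0 Z hZ, h0, mul_zero]
  have hi : ∀ i z, localExpr s i z = 0 := by
    intro i z
    by_cases hi : i = 0
    · rw [hi]; exact h0 z
    obtain ⟨k, hk⟩ := Fin.exists_succAbove_eq (x := 0) (y := i) (Ne.symm hi)
    have hc : Continuous fun t : ℂ => localExpr s i (Function.update z k t) :=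
      (s.2.2 i).continuous.comp (continuous_const.update k continuous_id)
    have := Continuous.ext_on (dense_compl_singleton (0 : ℂ)) hc continuous_const
      (g := fun _ => (0 : ℂ)) (fun t ht => h0' _ (by
        have : (affineLift i (Function.update z k t)).1 (i.succAbove k) = t := by
          simp [affineLift]
        rw [hk] at this
        rw [this]
        exact ht))
    simpa using congrFun this (z k)
  apply Subtype.ext
  funext Z
  obtain ⟨i, hZ⟩ : ∃ i, Z.1 i ≠ 0 := by
    by_contra! h
    exact Z.2 (funext h)
  rw [apply_eq_of_ne_zero s i Z hZ, hi]
  simp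

/-- A subset of a finite-dimensional complex vector space has Lebesgue measure zero
(in linear coordinates; the choice of the coordinates does not matter). -/
def IsLebesgueNull {V : Type*} [AddCommGroup V] [Module ℂ V] [FiniteDimensional ℂ V]
    (S : Set V) : Prop :=
  MeasureTheory.volume ((Module.finBasis ℂ V).equivFun '' S) = 0

/-! ### The Fubini–Study metric and its connection -/

/-- The function `|s|²` on `ℂPⁿ` for the Fubini–Study metric of `𝒪(m)`:
`|s|²([Z]) = |s(Z)|² / |Z|^{2m}`. -/
def normSq (s : H0 n m) : CP n → ℝ :=
  Projectivization.lift (fun Z : Punctured n => ‖s.1 Z‖ ^ 2 / (∑ i, ‖Z.1 i‖ ^ 2) ^ m) (by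
    rintro ⟨a, ha⟩ ⟨b, hb⟩ t (h : a = t • b)
    subst h
    have ht : t ≠ 0 := fun h => ha (by simp [h])
    have ht' : (‖t‖ ^ 2) ^ m ≠ 0 := by positivity
    have h1 := s.2.1 t ht ⟨b, hb⟩
    simp only at h1
    simp only [h1, Pi.smul_apply, smul_eq_mul, norm_mul, norm_pow, mul_pow, ← Finset.mul_sum]
    rw [← pow_mul, mul_comm m 2, pow_mul, mul_div_mul_left _ _ ht'])

/-- The Fubini–Study potential `φ = m log (1 + |z|²)` on an affine chart: `|eᵢ|² = e^{-φ}`. -/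
def potential (m : ℕ) (z : Fin n → ℂ) : ℝ := m * Real.log (1 + ∑ j, ‖z j‖ ^ 2)

/-- The `(1,0)`-part `∂g = (dg - i dg ∘ J) / 2` of the differential of a real function `g` at `z`,
evaluated at the tangent vector `v`. -/
def del (g : (Fin n → ℂ) → ℝ) (z v : Fin n → ℂ) : ℂ :=
  ((fderiv ℝ g z v : ℂ) - Complex.I * (fderiv ℝ g z (Complex.I • v) : ℂ)) / 2

/-- The Fubini–Study (Chern) connection: over `Uᵢ`, `∇s = (df - f ∂φ) ⊗ eᵢ`. This is the
coefficient of `eᵢ` in `∇_v s` at the point with affine coordinates `z`. -/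
def nabla (s : H0 n m) (i : Fin (n + 1)) (z v : Fin n → ℂ) : ℂ :=
  fderiv ℝ (localExpr s i) z v - localExpr s i z * del (potential m) z v

/-- `p` is a critical point of the section `s`: `∇s = 0` at `p`. -/
def IsCriticalPoint (s : H0 n m) (p : CP n) : Prop :=
  ∀ i z, affinePt i z = p → ∀ v, nabla s i z v = 0

/-- The critical point `p` of `s` is isolated in the set of critical points of `s`. -/
def IsIsolatedCritical (s : H0 n m) (p : CP n) : Prop :=
  ∃ U ∈ 𝓝 p, ∀ q ∈ U, IsCriticalPoint s q → q = p

/-! ### Hessians, and generalized Morse functions on `ℂPⁿ` -/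

/-- The expression of a function on `ℂPⁿ` in the `i`-th affine chart. -/
def inChart (f : CP n → ℝ) (i : Fin (n + 1)) (z : Fin n → ℂ) : ℝ := f (affinePt i z)

/-- The Hessian of `f` in the `i`-th affine chart (the `2n` real second partial derivatives); at a
critical point of `f` it is, as a bilinear form on the tangent space, independent of the chart. -/
def hessian (f : CP n → ℝ) (i : Fin (n + 1)) (z v w : Fin n → ℂ) : ℝ :=
  fderiv ℝ (fderiv ℝ (inChart f i)) z v w

/-- `p` is a non-degenerate critical point of the section `s`: `∇s = 0` at `p`, `s(p) ≠ 0`, and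
the real Hessian of `log |s|²` at `p` is non-degenerate. -/
def IsNondegenerateCritical (s : H0 n m) (p : CP n) : Prop :=
  IsCriticalPoint s p ∧ normSq s p ≠ 0 ∧
    ∀ i z, affinePt i z = p →
      ∀ v, (∀ w, hessian (fun q => Real.log (normSq s q)) i z v w = 0) → v = 0

/-- The set of critical points of a (smooth) function `f` on `ℂPⁿ`. -/
def critSet (f : CP n → ℝ) : Set (CP n) :=
  {p | ∀ i z, affinePt i z = p → fderiv ℝ (inChart f i) z = 0}

/-- `S ⊆ ℂⁿ = ℝ²ⁿ` is near its point `z` an embedded smooth real submanifold with tangent space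
`T` at `z`: some smooth local diffeomorphism `Φ` around `z` straightens `S` to a
real linear subspace `W`, and `T = (dΦ_z)⁻¹ W`. -/
def IsSubmanifoldAt (S : Set (Fin n → ℂ)) (z : Fin n → ℂ) (T : Submodule ℝ (Fin n → ℂ)) : Prop :=
  ∃ (Φ : OpenPartialHomeomorph (Fin n → ℂ) (Fin n → ℂ)) (W : Submodule ℝ (Fin n → ℂ)),
    z ∈ S ∧ z ∈ Φ.source ∧ ContDiffOn ℝ ∞ Φ Φ.source ∧ ContDiffOn ℝ ∞ Φ.symm Φ.target ∧
    (∀ x ∈ Φ.source, x ∈ S ↔ Φ x ∈ W) ∧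
    T = W.comap (fderiv ℝ Φ z).toLinearMap

/-- `N` is a non-degenerate critical manifold of `f`: a connected embedded submanifold of `ℂPⁿ`
along which `df = 0` and the Hessian is non-degenerate on the normal bundle `TℂPⁿ|_N / TN`, that
is, the null space of the Hessian of `f` at each point of `N` is the tangent space of `N`. -/
def IsNondegenerateCriticalManifold (f : CP n → ℝ) (N : Set (CP n)) : Prop :=
  IsConnected N ∧ N ⊆ critSet f ∧
    ∀ i z, affinePt i z ∈ N → ∃ T : Submodule ℝ (Fin n → ℂ),
      IsSubmanifoldAt (affinePt i ⁻¹' N) z T ∧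
      ∀ v, (∀ w, hessian f i z v w = 0) ↔ v ∈ T

/-- `f` is a generalized Morse (Morse–Bott) function on `ℂPⁿ`: it is smooth and its critical set
is a disjoint union of non-degenerate critical manifolds, its connected components. -/
def IsGeneralizedMorse (f : CP n → ℝ) : Prop :=
  (∀ i, ContDiff ℝ ∞ (inChart f i)) ∧
    ∀ p ∈ critSet f, IsNondegenerateCriticalManifold f (connectedComponentIn (critSet f) p)

end FubiniStudy

end

namespace FubiniStudy

/-! ### Parametric transversality from the equidimensional Sard theorem. -/

section Sard

open MeasureTheory

/-! In a chart write `s = f eᵢ` and `∇s = df - f ∂φ`, a field of complex linear forms. Everything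
follows from one generic property, `IsRegularOn`: wherever `∇s = 0`, `f ≠ 0` and the real derivative
of `∇s` is injective.

It holds almost everywhere by a transversality argument, `ae_regular_zeros`. Since `m ≥ 1`, in each
chart the sections include all affine functions `a z + b`. Fix the component of `s` in a complement
of these. With `c = a z + b`, the equation `∇s(z) = 0` can be solved for `a` in terms of `z` and
`c`, and then `b = c - a z`. So the incidence set `{(s, z) : ∇s(z) = 0}` is a graph over a space of
the same dimension as the space of sections. A degenerate zero makes `s` a critical value of the
projection to sections, and the pairs with `f(z) = 0` form a family with one complex parameter
fewer. Both images are null.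

Next, `d|s|² = Re (2 e^{-φ} f̄ ∇s)`, so the critical set of `|s|²` is the union of the zero locus of
`s` and the critical points of `s`. For regular `s` these are disjoint. On the zero locus `df = ∇s ≠
0`, so the locus is a smooth hypersurface whose tangent space `ker df` is the null space of the
Hessian. At a critical point of `s` the Hessians of `|s|²` and of `log |s|²` are real parts of a
nonzero multiple of the derivative of `∇s`, hence non-degenerate, and the point is isolated. -/

theorem det_eq_zero_of_apply_eq_zero {V : Type*} [NormedAddCommGroup V] [NormedSpace ℝ V]
    [FiniteDimensional ℝ V] (A : V →L[ℝ] V) {u : V} (hu : u ≠ 0) (h : A u = 0) : A.det = 0 := by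
  by_contra hd
  have := (LinearMap.equivOfDetNeZero (A : V →ₗ[ℝ] V) hd).injective
  exact hu (this (by simpa using h))

section ComplexLinearApply

variable {X G H : Type*} [NormedAddCommGroup X] [NormedSpace ℝ X]
  [NormedAddCommGroup G] [NormedSpace ℂ G] [NormedSpace ℝ G] [IsScalarTower ℝ ℂ G]
  [NormedAddCommGroup H] [NormedSpace ℂ H] [NormedSpace ℝ H] [IsScalarTower ℝ ℂ H]

/-- Real differentiability of the application of complex linear maps. -/
theorem hasFDerivAt_clm_apply_complex {c : X → G →L[ℂ] H} {u : X → G}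
    {c' : X →L[ℝ] (G →L[ℂ] H)} {u' : X →L[ℝ] G} {x : X}
    (hc : HasFDerivAt c c' x) (hu : HasFDerivAt u u' x) :
    HasFDerivAt (fun y => c y (u y))
      (((c x).restrictScalars ℝ).comp u' +
        ((ContinuousLinearMap.restrictScalarsL ℂ G H ℝ ℝ).comp c').flip (u x)) x :=
  ((ContinuousLinearMap.restrictScalarsL ℂ G H ℝ ℝ).hasFDerivAt.comp x hc).clm_apply hu

theorem differentiable_clm_apply_complex {c : X → G →L[ℂ] H} {u : X → G}
    (hc : Differentiable ℝ c) (hu : Differentiable ℝ u) :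
    Differentiable ℝ fun y => c y (u y) := fun x =>
  (hasFDerivAt_clm_apply_complex (hc x).hasFDerivAt (hu x).hasFDerivAt).differentiableAt

theorem hasDerivAt_clm_apply_complex {c : ℝ → G →L[ℂ] H} {u : ℝ → G} {c' : G →L[ℂ] H} {u' : G}
    {t : ℝ} (hc : HasDerivAt c c' t) (hu : HasDerivAt u u' t) :
    HasDerivAt (fun y => c y (u y)) (c t u' + c' (u t)) t := by
  have := (hasFDerivAt_clm_apply_complex hc.hasFDerivAt hu.hasFDerivAt).hasDerivAt
  simpa using this

end ComplexLinearApply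

variable {V E : Type*} [NormedAddCommGroup V] [NormedSpace ℂ V] [NormedSpace ℝ V]
  [IsScalarTower ℝ ℂ V] [FiniteDimensional ℂ V] [FiniteDimensional ℝ V]
  [MeasurableSpace V] [BorelSpace V]
  [NormedAddCommGroup E] [NormedSpace ℂ E] [NormedSpace ℝ E] [IsScalarTower ℝ ℂ E]
  [FiniteDimensional ℂ E]

/-- Parametric transversality for a linear family `x ↦ (e z x, P z x)` of `1`-jets: if the family
contains all affine functions `z ↦ a z + b`, then for almost every member `x` the zeros of
`z ↦ P z x` are regular, and `e z x` does not vanish there. -/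
theorem ae_regular_zeros (μ : Measure V) [μ.IsAddHaarMeasure]
    (e : E → V →L[ℂ] ℂ) (P : E → V →L[ℂ] (E →L[ℂ] ℂ))
    (he : Differentiable ℝ e) (hP : Differentiable ℝ P)
    (L : ((E →L[ℂ] ℂ) × ℂ) →L[ℂ] V) (θ : E → E →L[ℂ] ℂ)
    (heL : ∀ z a b, e z (L (a, b)) = a z + b)
    (hPL : ∀ z a b, P z (L (a, b)) = a - (a z + b) • θ z) :
    ∀ᵐ x ∂μ, ∀ z, P z x = 0 →
      e z x ≠ 0 ∧ ∀ v, fderiv ℝ (fun z => P z x) z v = 0 → v = 0 := by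
  have hθ : Differentiable ℝ θ := by
    have : θ = fun z => - P z (L (0, 1)) := by
      funext z; rw [hPL]; simp
    rw [this]
    exact (differentiable_clm_apply_complex hP (differentiable_const _)).neg
  have hinj : Function.Injective L := by
    refine (injective_iff_map_eq_zero L).2 fun ⟨a, b⟩ h => ?_
    have h1 : ∀ z, a z + b = 0 := fun z => by rw [← heL, h, map_zero]
    have hb : b = 0 := by simpa using h1 0
    have ha : a = 0 := by ext z; simpa [hb] using h1 z
    rw [ha, hb]; rfl
  have hL0 : L (0, 0) = 0 := map_zero L
  -- `J` reads off the affine part `(a, b)` of a parameter; `τ` below projects onto the complement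
  -- `ker J`.
  obtain ⟨J', hJ'⟩ := LinearMap.exists_leftInverse_of_injective L.toLinearMap
    (LinearMap.ker_eq_bot.2 hinj)
  let J : V →L[ℂ] (E →L[ℂ] ℂ) × ℂ := LinearMap.toContinuousLinearMap J'
  have hJ : ∀ y, J (L y) = y := fun y => LinearMap.congr_fun hJ' y
  -- `A` lets the slot of `V` that holds `a` hold a point `z` instead, so `V` itself parametrises
  -- the incidence set by `(τ, z, c)` and Sard is applied to a map `V → V`.
  obtain ⟨A⟩ : Nonempty (E ≃L[ℂ] (E →L[ℂ] ℂ)) := by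
    refine ⟨ContinuousLinearEquiv.ofFinrankEq ?_⟩
    rw [← LinearEquiv.finrank_eq (LinearMap.toContinuousLinearMap (𝕜 := ℂ) (E := E) (F' := ℂ))]
    exact (Subspace.dual_finrank_eq (K := ℂ) (V := E)).symm
  let τ : V → V := fun x => x - L (J x)
  let pz : V → E := fun x => A.symm (J x).1
  -- The solution `a = c θ(z) - P z τ` of `P z x = 0`, where `c = a z + b` is the last coordinate;
  -- `Γ` then recovers `b = c - a z`.
  let pa : V → E →L[ℂ] ℂ := fun x => (J x).2 • θ (pz x) - P (pz x) (τ x)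
  let Γ : V → V := fun x => τ x + L (pa x, (J x).2 - pa x (pz x))
  -- Forces `c = -e z τ`, that is, `e z x = 0`, whatever the last coordinate was.
  let κ : V → V := fun x => τ x + L (A (pz x), - e (pz x) (τ x))
  have hJd : Differentiable ℝ J := (J.restrictScalars ℝ).differentiable
  have hLd : Differentiable ℝ L := (L.restrictScalars ℝ).differentiable
  have hτ : Differentiable ℝ τ := by fun_prop
  have hpz : Differentiable ℝ pz :=
    ((A.symm : (E →L[ℂ] ℂ) →L[ℂ] E).restrictScalars ℝ).differentiable.comp hJd.fst
  have hAd : Differentiable ℝ A := ((A : E →L[ℂ] (E →L[ℂ] ℂ)).restrictScalars ℝ).differentiable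
  have hpa : Differentiable ℝ pa :=
    (hJd.snd.smul (hθ.comp hpz)).sub (differentiable_clm_apply_complex (hP.comp hpz) hτ)
  have hΓ : Differentiable ℝ Γ :=
    hτ.add (hLd.comp (hpa.prodMk (hJd.snd.sub (differentiable_clm_apply_complex hpa hpz))))
  have hκ : Differentiable ℝ κ :=
    hτ.add (hLd.comp ((hAd.comp hpz).prodMk
      (differentiable_clm_apply_complex (he.comp hpz) hτ).neg))
  have hτL : ∀ x y, τ (x + L y) = τ x := fun x y => by
    simp only [τ, map_add, hJ]; abel
  have hJτ : ∀ x, J (τ x) = 0 := fun x => by simp [τ, hJ]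
  have hττ : ∀ x, τ (τ x) = τ x := fun x => by
    change τ x - L (J (τ x)) = τ x
    simp [hJτ]
  -- the point of the parameter space lying over `(x, z)`
  have hsec : ∀ x z w, P z x = 0 →
      Γ (τ x + L (A z, (J x).1 z + (J x).2) + L (A w, (J x).1 w)) =
        x + L (- P (z + w) x, P (z + w) x (z + w)) := by
    intro x z w h
    -- Moving the point to `z + w` while keeping the affine part `(a, b)` of `x` gives `c = a (z +
    -- w) + b`. The solved-for form then differs from `a` by `-P (z + w) x`, so this term measures
    -- how far `Γ` moves from `x`.
    set y := τ x + L (A z, (J x).1 z + (J x).2) + L (A w, (J x).1 w) with hy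
    have h1 : τ y = τ x := by rw [hy, hτL, hτL, hττ]
    have h2 : J y = (A (z + w), (J x).1 (z + w) + (J x).2) := by
      rw [hy, map_add, map_add, hJτ, hJ, hJ, zero_add, Prod.mk_add_mk, map_add, map_add]
      congr 1; ring
    have h3 : pz y = z + w := by simp [pz, h2]
    have hx : x = τ x + L ((J x).1, (J x).2) := by simp [τ]
    have h4 : P (z + w) x = P (z + w) (τ x) +
        ((J x).1 - ((J x).1 (z + w) + (J x).2) • θ (z + w)) := by
      conv_lhs => rw [hx]
      rw [map_add, hPL]
    have h5 : pa y = (J x).1 - P (z + w) x := by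
      simp only [pa, h1, h2, h3]; rw [h4]; abel
    change τ y + L (pa y, (J y).2 - pa y (pz y)) = _
    rw [h1, h5, h3, h2]
    conv_rhs => rw [hx, add_assoc, ← map_add]
    congr 2
    refine Prod.ext ?_ ?_
    · simp only [Prod.fst_add]; rw [← hx]; abel
    · simp only [Prod.snd_add]; rw [← hx]; simp
  let C : Set V := {y | (fderiv ℝ Γ y).det = 0}
  have hC : μ (Γ '' C) = 0 := addHaar_image_eq_zero_of_det_fderivWithin_eq_zero μ
    (fun y _ => (hΓ y).hasFDerivAt.hasFDerivWithinAt) (fun y hy => hy)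
  have hK : μ (Set.range fun y => Γ (κ y)) = 0 := by
    rw [← Set.image_univ]
    refine addHaar_image_eq_zero_of_det_fderivWithin_eq_zero μ
      (fun y _ => (hΓ.comp hκ y).hasFDerivAt.hasFDerivWithinAt) fun y _ => ?_
    -- `κ` ignores the last coordinate, so `Γ ∘ κ` is constant along `L (0, 1)` and its derivative
    -- is singular everywhere.
    have hne : L (0, 1) ≠ 0 := fun h => by
      have := hinj (h.trans (map_zero L).symm)
      simp at this
    refine det_eq_zero_of_apply_eq_zero _ hne ?_
    have h1 : ∀ t : ℝ, (Γ ∘ κ) (y + t • L (0, 1)) = (Γ ∘ κ) y := by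
      intro t
      have h2 : t • L ((0 : E →L[ℂ] ℂ), (1 : ℂ)) = L (0, (t : ℂ)) := by
        refine ((L.restrictScalars ℝ).map_smul t (0, 1)).symm.trans ?_
        refine congrArg L (Prod.ext (ContinuousLinearMap.ext fun v => ?_) (by simp))
        exact smul_zero (A := ℂ) t
      have h3 : pz (y + L (0, (t : ℂ))) = pz y := by simp [pz, hJ]
      simp only [Function.comp, h2, κ, hτL, h3]
    have h2 : HasDerivAt (fun t : ℝ => (Γ ∘ κ) (y + t • L (0, 1)))
        (fderiv ℝ (Γ ∘ κ) y (L (0, 1))) 0 :=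
      (hΓ.comp hκ y).hasFDerivAt.hasLineDerivAt (L (0, 1))
    simp only [h1] at h2
    exact h2.unique (hasDerivAt_const _ _)
  filter_upwards [measure_eq_zero_iff_ae_notMem.1 hC, measure_eq_zero_iff_ae_notMem.1 hK]
    with x hx1 hx2 z hz
  have hx : x = τ x + L ((J x).1, (J x).2) := by simp [τ]
  set y := τ x + L (A z, (J x).1 z + (J x).2) with hy
  have hΓy : Γ y = x := by
    have := hsec x z 0 hz
    simpa [hz, hy, hL0] using this
  have hez : e z x = e z (τ x) + ((J x).1 z + (J x).2) := by
    conv_lhs => rw [hx, map_add, heL]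
  refine ⟨fun h0 => hx2 ⟨y, ?_⟩, fun v hv => ?_⟩
  · have h1 : pz y = z := by simp [pz, hy, hJτ, hJ]
    have h2 : τ y = τ x := by rw [hy, hτL, hττ]
    -- If `e z x = 0`, the last coordinate of `y` already equals `-e z (τ x)`, so `x = Γ y` would
    -- lie in the null range of `Γ ∘ κ`.
    have h3 : κ y = y := by
      simp only [κ, h1, h2]
      rw [hy]
      congr 3
      rw [hez] at h0
      linear_combination -h0
    simp only [h3, hΓy]
  · by_contra hv0
    -- A kernel vector `v` yields the singular direction `L (A v, a v)`: the point moves along `v`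
    -- with `(a, b)` fixed, and the displacement of `Γ` is controlled by `P (z + t v) x`, which
    -- vanishes to first order.
    refine hx1 ⟨y, ?_, hΓy⟩
    have hne : L (A v, (J x).1 v) ≠ 0 := fun h => by
      have := hinj (h.trans (map_zero L).symm)
      simp [hv0] at this
    refine det_eq_zero_of_apply_eq_zero _ hne ?_
    have hPx : Differentiable ℝ fun z => P z x :=
      differentiable_clm_apply_complex hP (differentiable_const _)
    have h1 : HasDerivAt (fun t : ℝ => P (z + t • v) x) 0 0 := by
      have := (hPx z).hasFDerivAt.hasLineDerivAt v
      rwa [hv] at this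
    have h2 : HasDerivAt (fun t : ℝ => P (z + t • v) x (z + t • v)) 0 0 := by
      have := hasDerivAt_clm_apply_complex h1 (((hasDerivAt_id (0 : ℝ)).smul_const v).const_add z)
      simpa [hz] using this
    have h3 : HasDerivAt (fun t : ℝ => Γ (y + t • L (A v, (J x).1 v)))
        (fderiv ℝ Γ y (L (A v, (J x).1 v))) 0 := (hΓ y).hasFDerivAt.hasLineDerivAt _
    have h4 : ∀ t : ℝ, Γ (y + t • L (A v, (J x).1 v)) =
        x + L (- P (z + t • v) x, P (z + t • v) x (z + t • v)) := by
      intro t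
      rw [← hsec x z _ hz, hy]
      congr 2
      refine ((L.restrictScalars ℝ).map_smul t _).symm.trans ?_
      exact congrArg L (Prod.ext
        ((A.toContinuousLinearMap.restrictScalars ℝ).map_smul t v).symm
        (((J x).1.restrictScalars ℝ).map_smul t v).symm)
    simp only [h4] at h3
    refine h3.unique ?_
    have h5 := ((L.restrictScalars ℝ).hasFDerivAt.comp_hasDerivAt (0 : ℝ)
      (h1.neg.prodMk h2)).const_add x
    simpa [hL0] using h5

end Sard

/-! ### Local expressions are polynomial; affine sections. -/

section Sections

variable {n m : ℕ}

/-- The Lagrange basis polynomials with nodes `0, …, m`. -/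
noncomputable def lagrangeNat (m : ℕ) (k : Fin (m + 1)) : Polynomial ℂ :=
  Lagrange.basis Finset.univ (fun k : Fin (m + 1) => ((k : ℕ) : ℂ)) k

/-- An entire function of growth `O(|t|^m)` is its own interpolation polynomial at `0, …, m`. -/
theorem entire_eq_interpolate (m : ℕ) (g : ℂ → ℂ) (hg : Differentiable ℂ g) (C : ℝ)
    (hC : ∀ t : ℂ, 1 ≤ ‖t‖ → ‖g t‖ ≤ C * ‖t‖ ^ m) (t : ℂ) :
    g t = ∑ k : Fin (m + 1), g ((k : ℕ) : ℂ) * (lagrangeNat m k).eval t := by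
  set v : Fin (m + 1) → ℂ := fun k => ((k : ℕ) : ℂ) with hv
  have hinj : Set.InjOn v (Finset.univ : Finset (Fin (m + 1))) := fun a _ b _ hab =>
    Fin.ext (by simpa [hv] using hab)
  let P := Lagrange.interpolate Finset.univ v (fun k => g (v k))
  have hPe : ∀ t, P.eval t = ∑ k : Fin (m + 1), g (v k) * (lagrangeNat m k).eval t := by
    intro t
    simp [P, Lagrange.interpolate_apply, Polynomial.eval_finsetSum, lagrangeNat, hv]
  have hdeg : P.natDegree ≤ m := by
    have h1 := Lagrange.degree_interpolate_lt (fun k => g (v k)) hinj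
    rw [Finset.card_univ, Fintype.card_fin] at h1
    rcases eq_or_ne P 0 with h0 | h0
    · simp [h0]
    · exact Nat.lt_succ_iff.1 ((Polynomial.natDegree_lt_iff_degree_lt h0).2 h1)
  have hPb : ∀ t : ℂ, 1 ≤ ‖t‖ →
      ‖P.eval t‖ ≤ (∑ k ∈ Finset.range (m + 1), ‖P.coeff k‖) * ‖t‖ ^ m := by
    intro t ht
    rw [Polynomial.eval_eq_sum_range' (Nat.lt_succ_of_le hdeg), Finset.sum_mul]
    refine (norm_sum_le _ _).trans (Finset.sum_le_sum fun k hk => ?_)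
    rw [norm_mul, norm_pow]
    gcongr
    exact Nat.lt_succ_iff.1 (Finset.mem_range.1 hk)
  have := entire_eq_zero m (fun t => g t - P.eval t) (hg.sub P.differentiable)
    (C + ∑ k ∈ Finset.range (m + 1), ‖P.coeff k‖)
    (fun t ht => by
      rw [add_mul]
      exact (norm_sub_le _ _).trans (add_le_add (hC t ht) (hPb t ht)))
    (fun k hk => by
      have h2 := Lagrange.eval_interpolate_at_node (fun k => g (v k)) hinj
        (Finset.mem_univ (⟨k, Nat.lt_succ_of_le hk⟩ : Fin (m + 1)))
      have h3 : v ⟨k, Nat.lt_succ_of_le hk⟩ = k := rfl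
      rw [h3] at h2
      exact sub_eq_zero.2 h2.symm)
  have h3 := congrFun this t
  rw [← hPe]
  exact sub_eq_zero.1 h3

/-- Dividing the homogeneous coordinates by `t` passes to the chart where the growing coordinate is
`1`. There the section is evaluated at points depending continuously on `1/t`, which stays in the
closed unit disc; homogeneity contributes the factor `t^m`. -/
theorem norm_localExpr_update_le (s : H0 n m) (i : Fin (n + 1)) (z : Fin n → ℂ) (j : Fin n) :
    ∃ C : ℝ, ∀ t : ℂ, 1 ≤ ‖t‖ → ‖localExpr s i (Function.update z j t)‖ ≤ C * ‖t‖ ^ m := by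
  set l := i.succAbove j with hl
  let Y : Fin (n + 1) → ℂ := (affineLift i (Function.update z j 0)).1
  have hcont : Continuous fun u : ℂ =>
      localExpr s l (fun k => u * Y (l.succAbove k)) :=
    (s.2.2 l).continuous.comp (by fun_prop)
  obtain ⟨C, hC⟩ := (isCompact_closedBall (0 : ℂ) 1).exists_bound_of_continuousOn
    hcont.continuousOn
  refine ⟨C, fun t ht => ?_⟩
  have ht0 : t ≠ 0 := fun h => by simp [h] at ht; linarith
  have hj : (affineLift i (Function.update z j t)).1 l = t := by simp [affineLift, hl]
  have h1 := apply_eq_of_ne_zero s l (affineLift i (Function.update z j t))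
    (by rw [hj]; exact ht0)
  have h2 : ∀ k, (affineLift i (Function.update z j t)).1 (l.succAbove k)
      = Y (l.succAbove k) := by
    intro k
    have hne := Fin.succAbove_ne l k
    generalize l.succAbove k = o at hne
    revert hne
    refine Fin.succAboveCases i ?_ (fun o' hne => ?_) o
    · intro _; simp [Y, affineLift]
    · have : o' ≠ j := fun h => hne (by rw [h])
      simp [Y, affineLift, this]
  simp only [hj, h2] at h1
  rw [localExpr, h1, norm_mul, norm_pow, mul_comm]
  gcongr
  apply hC
  rw [mem_closedBall_zero_iff, norm_inv]
  exact inv_le_one_of_one_le₀ ht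

theorem differentiable_localExpr (s : H0 n m) (i : Fin (n + 1)) :
    Differentiable ℂ (localExpr s i) := s.2.2 i

/-- The local expressions of holomorphic sections are polynomial, hence smooth. -/
theorem contDiff_localExpr (s : H0 n m) (i : Fin (n + 1)) : ContDiff ℂ ∞ (localExpr s i) := by
  -- Interpolation in one variable at a time: the coordinates in `A` vary and the others are frozen
  -- at `w`. Adding `b` to `A` expresses the function through its values with coordinate `b` frozen
  -- at `0, …, m`.
  have key : ∀ A : Finset (Fin n), ∀ w : Fin n → ℂ,
      ContDiff ℂ ∞ fun z : Fin n → ℂ => localExpr s i (A.piecewise z w) := by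
    intro A
    induction A using Finset.induction_on with
    | empty => intro w; simpa using contDiff_const
    | insert b A hb ih =>
      intro w
      have h : (fun z : Fin n → ℂ => localExpr s i ((insert b A).piecewise z w)) =
          fun z => ∑ k : Fin (m + 1),
            localExpr s i (A.piecewise z (Function.update w b ((k : ℕ) : ℂ))) *
              (lagrangeNat m k).eval (z b) := by
        funext z
        obtain ⟨C, hC⟩ := norm_localExpr_update_le s i (A.piecewise z w) b
        have hd : Differentiable ℂ fun t : ℂ =>
            localExpr s i (Function.update (A.piecewise z w) b t) := by
          refine (differentiable_localExpr s i).comp (differentiable_pi.2 fun j => ?_)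
          by_cases h : j = b
          · subst h; simp
          · simp [h]
        have h1 := entire_eq_interpolate m _ hd C hC (z b)
        rw [Finset.piecewise_insert, h1]
        refine Finset.sum_congr rfl fun k _ => ?_
        rw [Finset.update_piecewise_of_notMem _ _ _ hb]
      rw [h]
      refine ContDiff.sum fun k _ => (ih _).mul ?_
      exact (lagrangeNat m k).differentiable.contDiff.comp (contDiff_apply ℂ ℂ b)
  simpa using key Finset.univ 0

theorem contDiff_affineLift (i k : Fin (n + 1)) :
    ContDiff ℂ ∞ fun z : Fin n → ℂ => (affineLift i z).1 k := by
  refine Fin.succAboveCases i ?_ (fun k => ?_) k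
  · simpa [affineLift] using contDiff_const
  · simpa [affineLift] using contDiff_apply ℂ ℂ k

/-- The section `Zᵢ^{m-1} (∑ aⱼ Zⱼ + b Zᵢ)`, whose local expression over `Uᵢ` is `a z + b`. -/
noncomputable def affineSection (hm : 1 ≤ m) (i : Fin (n + 1)) :
    (((Fin n → ℂ) →L[ℂ] ℂ) × ℂ) →ₗ[ℂ] H0 n m where
  toFun ab := ⟨fun Z => (Z.1 i) ^ (m - 1) *
      (ab.1 (fun k => Z.1 (i.succAbove k)) + ab.2 * Z.1 i), by
    refine ⟨fun c hc Z => ?_, fun l => ?_⟩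
    · have h : (ab.1 fun k => c * Z.1 (i.succAbove k)) = c * ab.1 fun k => Z.1 (i.succAbove k) :=
        ab.1.map_smul c _
      obtain ⟨m, rfl⟩ := Nat.exists_eq_add_of_le' hm
      simp only [Pi.smul_apply, smul_eq_mul, Nat.add_sub_cancel, h]
      ring
    · have h := fun k => (contDiff_affineLift (n := n) l k).differentiable (by simp)
      have h2 : Differentiable ℂ fun z : Fin n → ℂ =>
          fun k => (affineLift l z).1 (i.succAbove k) := differentiable_pi.2 fun k => h _
      exact ((h i).pow _).mul ((ab.1.differentiable.comp h2).add ((h i).const_mul _))⟩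
  map_add' x y := by
    apply Subtype.ext; funext Z
    simp only [Prod.fst_add, Prod.snd_add, add_apply, Submodule.coe_add,
      Pi.add_apply]
    ring
  map_smul' c x := by
    apply Subtype.ext; funext Z
    simp only [Prod.smul_fst, Prod.smul_snd, smul_apply, Submodule.coe_smul,
      Pi.smul_apply, smul_eq_mul, RingHom.id_apply]
    ring

theorem localExpr_affineSection (hm : 1 ≤ m) (i : Fin (n + 1)) (a : (Fin n → ℂ) →L[ℂ] ℂ) (b : ℂ)
    (z : Fin n → ℂ) : localExpr (affineSection hm i (a, b)) i z = a z + b := by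
  simp [localExpr, affineSection, affineLift]

end Sections

/-! ### The affine charts as open embeddings covering projective space. -/

section Charts

variable {n m : ℕ}

theorem continuous_mk : Continuous fun Z : Punctured n => (Projectivization.mk ℂ Z.1 Z.2 : CP n) :=
  continuous_coinduced_rng

theorem affinePt_eq_mk_iff (i : Fin (n + 1)) (z : Fin n → ℂ) (Z : Punctured n) :
    affinePt i z = Projectivization.mk ℂ Z.1 Z.2 ↔
      Z.1 i ≠ 0 ∧ z = fun k => (Z.1 i)⁻¹ * Z.1 (i.succAbove k) := by
  rw [affinePt, Projectivization.mk_eq_mk_iff']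
  constructor
  · rintro ⟨a, ha⟩
    have h1 : a * Z.1 i = 1 := by simpa [affineLift] using congrFun ha i
    have h2 : Z.1 i ≠ 0 := right_ne_zero_of_mul_eq_one h1
    refine ⟨h2, funext fun k => ?_⟩
    have h3 := congrFun ha (i.succAbove k)
    simp only [Pi.smul_apply, smul_eq_mul, affineLift, Fin.insertNth_apply_succAbove] at h3
    rw [← h3, eq_inv_of_mul_eq_one_left h1]
  · rintro ⟨h, rfl⟩
    refine ⟨(Z.1 i)⁻¹, funext fun j => ?_⟩
    refine Fin.succAboveCases i ?_ (fun k => ?_) j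
    · simp [affineLift, h]
    · simp [affineLift]

theorem continuous_affinePt (i : Fin (n + 1)) : Continuous (affinePt (n := n) i) := by
  refine continuous_mk.comp (Continuous.subtype_mk (continuous_pi fun k => ?_) _)
  exact (contDiff_affineLift i k).continuous

/-- Carries neighbourhoods in coordinates to neighbourhoods in the quotient topology, which is how
isolation of critical points descends to `CP n`. -/
theorem isOpenMap_affinePt (i : Fin (n + 1)) : IsOpenMap (affinePt (n := n) i) := by
  intro W hW
  refine isOpen_coinduced.2 ?_
  have h : (fun Z : Punctured n => (Projectivization.mk ℂ Z.1 Z.2 : CP n)) ⁻¹' (affinePt i '' W) =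
      {Z : Punctured n | Z.1 i ≠ 0 ∧ (fun k => (Z.1 i)⁻¹ * Z.1 (i.succAbove k)) ∈ W} := by
    ext Z
    simp only [Set.mem_preimage, Set.mem_image, Set.mem_ofPred_eq, affinePt_eq_mk_iff]
    constructor
    · rintro ⟨z, hz, h, rfl⟩
      exact ⟨h, hz⟩
    · rintro ⟨h, hz⟩
      exact ⟨_, hz, h, rfl⟩
  rw [h]
  have hc : ∀ k, Continuous fun Z : Punctured n => Z.1 k := fun k =>
    (continuous_apply k).comp continuous_subtype_val
  have ho : IsOpen {Z : Punctured n | Z.1 i ≠ 0} := isOpen_ne_fun (hc i) continuous_const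
  refine ContinuousOn.isOpen_inter_preimage (f := fun Z : Punctured n =>
    (fun k => (Z.1 i)⁻¹ * Z.1 (i.succAbove k))) ?_ ho hW
  exact continuousOn_pi.2 fun k =>
    ((hc i).continuousOn.inv₀ fun Z hZ => hZ).mul (hc _).continuousOn

theorem exists_affinePt_eq (p : CP n) : ∃ i z, affinePt i z = p := by
  induction p using Projectivization.ind with
  | h Z hZ =>
    obtain ⟨i, hi⟩ : ∃ i, Z i ≠ 0 := by
      by_contra! h
      exact hZ (funext h)
    exact ⟨i, _, (affinePt_eq_mk_iff i _ ⟨Z, hZ⟩).2 ⟨hi, rfl⟩⟩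

end Charts

/-! ### The Fubini–Study potential and its `(1,0)`-form. -/

section Potential

variable {n : ℕ} (m : ℕ)

/-- The positive function `1 + |z|²`. -/
noncomputable def onePlus (z : Fin n → ℂ) : ℝ := 1 + ∑ j, ‖z j‖ ^ 2

theorem onePlus_pos (z : Fin n → ℂ) : 0 < onePlus z := by
  have : 0 ≤ ∑ j, ‖z j‖ ^ 2 := by positivity
  unfold onePlus; linarith

/-- The complex linear form `v ↦ ∑ z̄ⱼ vⱼ`. -/
noncomputable def conjForm (z : Fin n → ℂ) : (Fin n → ℂ) →L[ℂ] ℂ :=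
  ∑ j, (starRingEnd ℂ (z j)) • ContinuousLinearMap.proj (R := ℂ) (φ := fun _ : Fin n => ℂ) j

theorem contDiff_conjForm : ContDiff ℝ ∞ (conjForm (n := n)) := by
  unfold conjForm
  refine ContDiff.sum fun j _ => ContDiff.fun_smul ?_ contDiff_const
  exact Complex.conjCLE.contDiff.comp (contDiff_apply ℝ ℂ j)

theorem hasFDerivAt_onePlus (z : Fin n → ℂ) :
    HasFDerivAt (onePlus (n := n))
      ((2 : ℝ) • Complex.reCLM.comp ((conjForm z).restrictScalars ℝ)) z := by
  have h : ∀ j : Fin n, HasFDerivAt (fun z : Fin n → ℂ => ‖z j‖ ^ 2)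
      ((2 : ℝ) • (innerSL ℝ (z j)).comp (ContinuousLinearMap.proj (R := ℝ) j)) z := fun j =>
    (hasFDerivAt_apply (𝕜 := ℝ) (F' := fun _ : Fin n => ℂ) j z).norm_sq.congr_fderiv
      (by ext; simp; ring)
  refine ((HasFDerivAt.fun_sum (u := Finset.univ) fun j _ => h j).const_add 1).congr_fderiv ?_
  ext v
  simp only [conjForm, Complex.inner, Finset.mul_sum, sum_apply, smul_apply,
    ContinuousLinearMap.comp_apply, ContinuousLinearMap.proj_apply, innerSL_apply_apply,
    smul_eq_mul, Complex.reCLM_apply, ContinuousLinearMap.coe_restrictScalars', Complex.re_sum]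
  exact Finset.sum_congr rfl fun i _ => by rw [mul_comm (v i)]

theorem contDiff_onePlus : ContDiff ℝ ∞ (onePlus (n := n)) := by
  unfold onePlus
  exact contDiff_const.add (ContDiff.sum fun j _ => (contDiff_apply ℝ ℂ j).norm_sq ℝ)

/-- The form `∂φ` for the Fubini–Study potential. -/
noncomputable def delPotential (z : Fin n → ℂ) : (Fin n → ℂ) →L[ℂ] ℂ :=
  ((m / onePlus z : ℝ) : ℂ) • conjForm z

theorem contDiff_delPotential : ContDiff ℝ ∞ (delPotential (n := n) m) := by
  unfold delPotential
  refine ContDiff.fun_smul ?_ contDiff_conjForm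
  exact Complex.ofRealCLM.contDiff.comp
    (contDiff_const.div contDiff_onePlus fun z => (onePlus_pos z).ne')

theorem contDiff_potential : ContDiff ℝ ∞ (potential (n := n) m) :=
  contDiff_const.mul (contDiff_onePlus.log fun z => (onePlus_pos z).ne')

theorem fderiv_potential (z v : Fin n → ℂ) :
    fderiv ℝ (potential m) z v = 2 * (delPotential m z v).re := by
  have h := ((hasFDerivAt_onePlus z).log (onePlus_pos z).ne').const_mul (m : ℝ)
  have h2 : HasFDerivAt (potential m) _ z := h
  rw [h2.fderiv]
  simp only [smul_apply, ContinuousLinearMap.comp_apply, smul_eq_mul, delPotential,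
    Complex.re_ofReal_mul, Complex.reCLM_apply, ContinuousLinearMap.coe_restrictScalars']
  field_simp

/-- The differential of the potential is twice the real part of a complex linear form, and that form
is then its `(1,0)`-part. -/
theorem del_potential (z v : Fin n → ℂ) : del (potential m) z v = delPotential m z v := by
  rw [del, fderiv_potential, fderiv_potential, map_smul]
  apply Complex.ext
  · simp
  · simp

theorem exp_neg_potential (z : Fin n → ℂ) :
    Real.exp (- potential m z) = ((onePlus z) ^ m)⁻¹ := by
  change Real.exp (-(m * Real.log (onePlus z))) = _
  rw [Real.exp_neg, mul_comm, Real.exp_mul, Real.exp_log (onePlus_pos z), Real.rpow_natCast]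

end Potential

/-! ### The norm and the connection in a chart. -/

section LocalExpressions

variable {n m : ℕ}

theorem normSq_affinePt (s : H0 n m) (i : Fin (n + 1)) (z : Fin n → ℂ) :
    normSq s (affinePt i z) = ‖localExpr s i z‖ ^ 2 * Real.exp (- potential m z) := by
  rw [exp_neg_potential, ← div_eq_mul_inv]
  have h : ∑ k, ‖(affineLift i z).1 k‖ ^ 2 = onePlus z := by
    rw [Fin.sum_univ_succAbove _ i]
    simp [affineLift, onePlus]
  rw [← h]
  rfl

/-- The coefficient of `eᵢ` in `∇s` at `z`, as a complex linear form. -/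
noncomputable def covDeriv (s : H0 n m) (i : Fin (n + 1)) (z : Fin n → ℂ) : (Fin n → ℂ) →L[ℂ] ℂ :=
  fderiv ℂ (localExpr s i) z - localExpr s i z • delPotential m z

theorem fderiv_real_localExpr (s : H0 n m) (i : Fin (n + 1)) (z v : Fin n → ℂ) :
    fderiv ℝ (localExpr s i) z v = fderiv ℂ (localExpr s i) z v := by
  rw [((differentiable_localExpr s i z).hasFDerivAt.restrictScalars ℝ).fderiv]
  rfl

theorem nabla_eq_covDeriv (s : H0 n m) (i : Fin (n + 1)) (z v : Fin n → ℂ) :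
    nabla s i z v = covDeriv s i z v := by
  rw [nabla, fderiv_real_localExpr, del_potential]
  rfl

theorem contDiff_real_localExpr (s : H0 n m) (i : Fin (n + 1)) :
    ContDiff ℝ ∞ (localExpr s i) := (contDiff_localExpr s i).restrict_scalars ℝ

theorem contDiff_covDeriv (s : H0 n m) (i : Fin (n + 1)) : ContDiff ℝ ∞ (covDeriv s i) :=
  (((contDiff_localExpr s i).fderiv_right (m := ∞) (by simp)).restrict_scalars ℝ).sub
    ((contDiff_real_localExpr s i).smul (contDiff_delPotential m))

end LocalExpressions

/-! ### Regularity of almost every section over one chart. -/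

section Generic

open MeasureTheory

variable {n m : ℕ}

/-- Over `Uᵢ`, the zeros of `∇s` are regular and are not zeros of `s`. -/
def IsRegularOn (s : H0 n m) (i : Fin (n + 1)) : Prop :=
  ∀ z, covDeriv s i z = 0 →
    localExpr s i z ≠ 0 ∧ ∀ v, fderiv ℝ (covDeriv s i) z v = 0 → v = 0

/-- Evaluation of local expressions, as a linear map. -/
def evalₗ (i : Fin (n + 1)) (z : Fin n → ℂ) : H0 n m →ₗ[ℂ] ℂ where
  toFun s := localExpr s i z
  map_add' _ _ := rfl
  map_smul' _ _ := rfl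

/-- The covariant derivative at a point, as a linear map on sections. -/
noncomputable def covDerivₗ (i : Fin (n + 1)) (z : Fin n → ℂ) :
    H0 n m →ₗ[ℂ] ((Fin n → ℂ) →L[ℂ] ℂ) where
  toFun s := covDeriv s i z
  map_add' s t := by
    have h : localExpr (s + t) i = fun z => localExpr s i z + localExpr t i z := rfl
    simp only [covDeriv, h]
    rw [fderiv_fun_add (differentiable_localExpr s i z) (differentiable_localExpr t i z)]
    ext v
    simp
    ring
  map_smul' c s := by
    have h : localExpr (c • s) i = fun z => c • localExpr s i z := rfl
    simp only [covDeriv, h]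
    rw [fderiv_fun_const_smul (differentiable_localExpr s i z)]
    ext v
    simp
    ring

theorem covDeriv_affineSection (hm : 1 ≤ m) (i : Fin (n + 1)) (a : (Fin n → ℂ) →L[ℂ] ℂ) (b : ℂ)
    (z : Fin n → ℂ) :
    covDeriv (affineSection hm i (a, b)) i z = a - (a z + b) • delPotential m z := by
  have h : localExpr (affineSection hm i (a, b)) i = fun z => a z + b :=
    funext fun z => localExpr_affineSection hm i a b z
  rw [covDeriv, h, (a.hasFDerivAt.add_const b).fderiv]

/-- In coordinates for a basis of sections, evaluation and `∇` become linear families to which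
`ae_regular_zeros` applies; the affine sections supply the required map `L`, with `θ = ∂φ`. -/
theorem isLebesgueNull_not_isRegularOn (hm : 1 ≤ m) (i : Fin (n + 1)) :
    IsLebesgueNull {s : H0 n m | ¬ IsRegularOn s i} := by
  let B := Module.finBasis ℂ (H0 n m)
  let d := Module.finrank ℂ (H0 n m)
  let e : (Fin n → ℂ) → (Fin d → ℂ) →L[ℂ] ℂ := fun z =>
    ∑ k, localExpr (B k) i z • ContinuousLinearMap.proj k
  let P : (Fin n → ℂ) → (Fin d → ℂ) →L[ℂ] ((Fin n → ℂ) →L[ℂ] ℂ) := fun z =>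
    ∑ k, (ContinuousLinearMap.smulRightL ℂ (Fin d → ℂ) ((Fin n → ℂ) →L[ℂ] ℂ)
      (ContinuousLinearMap.proj k)) (covDeriv (B k) i z)
  let L : ((((Fin n → ℂ) →L[ℂ] ℂ) × ℂ)) →L[ℂ] (Fin d → ℂ) :=
    LinearMap.toContinuousLinearMap (B.equivFun.toLinearMap ∘ₗ affineSection hm i)
  have hes : ∀ s z, localExpr s i z = e z (B.equivFun s) := fun s z => by
    change evalₗ i z s = _
    conv_lhs => rw [← B.sum_equivFun s, map_sum]
    simp only [map_smul, e, sum_apply, smul_apply, ContinuousLinearMap.proj_apply, smul_eq_mul]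
    exact Finset.sum_congr rfl fun k _ => mul_comm _ _
  have hPs : ∀ s z, covDeriv s i z = P z (B.equivFun s) := fun s z => by
    change covDerivₗ i z s = _
    conv_lhs => rw [← B.sum_equivFun s, map_sum]
    simp only [map_smul, P, sum_apply]
    rfl
  have he : Differentiable ℝ e := by
    refine Differentiable.fun_sum fun k _ => Differentiable.fun_smul ?_ (differentiable_const _)
    exact (contDiff_real_localExpr (B k) i).differentiable (by simp)
  have hP : Differentiable ℝ P := by
    have h : ∀ k, Differentiable ℝ fun z => (ContinuousLinearMap.smulRightL ℂ (Fin d → ℂ)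
        ((Fin n → ℂ) →L[ℂ] ℂ) (ContinuousLinearMap.proj k)) (covDeriv (B k) i z) := fun k =>
      differentiable_clm_apply_complex (G := (Fin n → ℂ) →L[ℂ] ℂ)
        (H := (Fin d → ℂ) →L[ℂ] ((Fin n → ℂ) →L[ℂ] ℂ)) (differentiable_const _)
        ((contDiff_covDeriv (B k) i).differentiable (by simp))
    exact Differentiable.fun_sum (𝕜 := ℝ) (E := Fin n → ℂ)
      (F := (Fin d → ℂ) →L[ℂ] ((Fin n → ℂ) →L[ℂ] ℂ)) fun k _ => h k
  have hL : ∀ ab, L ab = B.equivFun (affineSection hm i ab) := fun ab => rfl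
  have key := ae_regular_zeros volume e P he hP L (delPotential m)
    (fun z a b => by rw [hL, ← hes, localExpr_affineSection])
    (fun z a b => by rw [hL, ← hPs, covDeriv_affineSection])
  refine measure_mono_null ?_ (ae_iff.1 key)
  rintro _ ⟨s, hs, rfl⟩
  intro h
  refine hs fun z hz => ?_
  have h1 : covDeriv s i = fun z => P z (B.equivFun s) := funext fun z => hPs s z
  rw [h1, hes]
  exact h z (by rw [← hPs, hz])

end Generic

/-! ### First and second derivatives of `|s|²` and `log |s|²`. -/

section Hessian

variable {n m : ℕ}

/-- The real part of a complex linear form. -/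
noncomputable def reForm : ((Fin n → ℂ) →L[ℂ] ℂ) →L[ℝ] ((Fin n → ℂ) →L[ℝ] ℝ) :=
  (ContinuousLinearMap.compL ℝ (Fin n → ℂ) ℂ ℝ Complex.reCLM).comp
    (ContinuousLinearMap.restrictScalarsL ℂ (Fin n → ℂ) ℂ ℝ ℝ)

@[simp]
theorem reForm_apply (α : (Fin n → ℂ) →L[ℂ] ℂ) (w : Fin n → ℂ) : reForm α w = (α w).re := rfl

/-- Evaluating at `i w` recovers the imaginary part, up to sign. This removes the real parts from
the gradient and Hessian conditions. -/
theorem forall_re_eq_zero_iff (α : (Fin n → ℂ) →L[ℂ] ℂ) : (∀ w, (α w).re = 0) ↔ α = 0 := by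
  refine ⟨fun h => ?_, fun h w => by simp [h]⟩
  ext w
  refine Complex.ext (h w) ?_
  have := h (Complex.I • w)
  simpa using this

theorem smul_form_eq_zero_iff (c : ℂ) (α : (Fin n → ℂ) →L[ℂ] ℂ) :
    c • α = 0 ↔ c = 0 ∨ α = 0 :=
  smul_eq_zero (R := ℂ) (M := (Fin n → ℂ) →L[ℂ] ℂ)

theorem smul_add_smul_zero_eq_zero_iff {c : ℂ} (hc : c ≠ 0) (d : ℂ)
    (α : (Fin n → ℂ) →L[ℂ] ℂ) : c • α + d • (0 : (Fin n → ℂ) →L[ℂ] ℂ) = 0 ↔ α = 0 := by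
  have h : d • (0 : (Fin n → ℂ) →L[ℂ] ℂ) = 0 := by ext; simp
  rw [h, add_zero, smul_form_eq_zero_iff, or_iff_right hc]

theorem zero_smul_add_smul_eq_zero_iff (d : ℂ) (α : (Fin n → ℂ) →L[ℂ] ℂ)
    {β : (Fin n → ℂ) →L[ℂ] ℂ} (hβ : β ≠ 0) : (0 : ℂ) • α + d • β = 0 ↔ d = 0 := by
  have h : (0 : ℂ) • α = 0 := zero_smul ℂ α
  rw [h, zero_add, smul_form_eq_zero_iff, or_iff_left hβ]

theorem reForm_eq_zero_iff (α : (Fin n → ℂ) →L[ℂ] ℂ) : reForm α = 0 ↔ α = 0 := by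
  rw [← forall_re_eq_zero_iff, ContinuousLinearMap.ext_iff]
  rfl

/-- Differentiation of a product of a function and a field of complex linear forms. -/
theorem fderiv_reForm_smul {g : (Fin n → ℂ) → ℂ} {α : (Fin n → ℂ) → (Fin n → ℂ) →L[ℂ] ℂ}
    {z : Fin n → ℂ} (hg : DifferentiableAt ℝ g z) (hα : DifferentiableAt ℝ α z)
    (v : Fin n → ℂ) :
    fderiv ℝ (fun x => reForm (g x • α x)) z v =
      reForm (g z • fderiv ℝ α z v + fderiv ℝ g z v • α z) := by
  have h := reForm.hasFDerivAt.comp z (hg.hasFDerivAt.fun_smul hα.hasFDerivAt)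
  have h2 : HasFDerivAt (fun x => reForm (g x • α x)) _ z := h
  rw [h2.fderiv]
  rfl

/-- The factor `2 e^{-φ} f̄` in `d|s|² = Re (2 e^{-φ} f̄ ∇s)`. -/
noncomputable def conjWeight (s : H0 n m) (i : Fin (n + 1)) (z : Fin n → ℂ) : ℂ :=
  (2 * Real.exp (- potential m z)) • (starRingEnd ℂ) (localExpr s i z)

theorem conjWeight_eq_zero_iff (s : H0 n m) (i : Fin (n + 1)) (z : Fin n → ℂ) :
    conjWeight s i z = 0 ↔ localExpr s i z = 0 := by
  simp [conjWeight]

theorem contDiff_inChart_normSq (s : H0 n m) (i : Fin (n + 1)) :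
    ContDiff ℝ ∞ (inChart (normSq s) i) := by
  have h : inChart (normSq s) i =
      fun z => ‖localExpr s i z‖ ^ 2 * Real.exp (- potential m z) :=
    funext fun z => normSq_affinePt s i z
  rw [h]
  exact ((contDiff_real_localExpr s i).norm_sq ℝ).mul (contDiff_potential m).neg.exp

theorem hasFDerivAt_inChart_normSq (s : H0 n m) (i : Fin (n + 1)) (z : Fin n → ℂ) :
    HasFDerivAt (inChart (normSq s) i) (reForm (conjWeight s i z • covDeriv s i z)) z := by
  have h : inChart (normSq s) i =
      fun z => ‖localExpr s i z‖ ^ 2 * Real.exp (- potential m z) :=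
    funext fun z => normSq_affinePt s i z
  rw [h]
  have h1 := ((contDiff_real_localExpr s i).differentiable (by simp) z).hasFDerivAt.norm_sq
  have h2 := ((contDiff_potential (n := n) m).differentiable (by simp) z).hasFDerivAt.neg.exp
  refine (h1.mul h2).congr_fderiv ?_
  ext w
  simp only [reForm_apply, conjWeight, covDeriv, add_apply, smul_apply, neg_apply, sub_apply,
    smul_eq_mul, ContinuousLinearMap.comp_apply, innerSL_apply_apply, fderiv_real_localExpr,
    fderiv_potential, Complex.inner, Pi.neg_apply, Complex.sq_norm, Complex.normSq_apply]
  generalize Real.exp (- potential m z) = r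
  simp
  ring

theorem fderiv_inChart_normSq (s : H0 n m) (i : Fin (n + 1)) :
    fderiv ℝ (inChart (normSq s) i) = fun z => reForm (conjWeight s i z • covDeriv s i z) :=
  funext fun z => (hasFDerivAt_inChart_normSq s i z).fderiv

/-- Since `d|s|²` is the real part of `2 e^{-φ} f̄ ∇s`, the critical set splits into the zeros of
`s` and the zeros of `∇s`. -/
theorem fderiv_inChart_normSq_eq_zero_iff (s : H0 n m) (i : Fin (n + 1)) (z : Fin n → ℂ) :
    fderiv ℝ (inChart (normSq s) i) z = 0 ↔ localExpr s i z = 0 ∨ covDeriv s i z = 0 := by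
  rw [fderiv_inChart_normSq, reForm_eq_zero_iff, smul_form_eq_zero_iff, conjWeight_eq_zero_iff]

theorem differentiable_conjWeight (s : H0 n m) (i : Fin (n + 1)) :
    Differentiable ℝ (conjWeight s i) := by
  refine Differentiable.fun_smul ?_ ?_
  · exact ((contDiff_potential m).differentiable (by simp)).neg.exp.const_mul 2
  · exact Complex.conjCLE.differentiable.comp
      ((contDiff_real_localExpr s i).differentiable (by simp))

theorem fderiv_conjWeight_of_eq_zero (s : H0 n m) (i : Fin (n + 1)) {z : Fin n → ℂ}
    (hz : localExpr s i z = 0) (v : Fin n → ℂ) :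
    fderiv ℝ (conjWeight s i) z v = (2 * Real.exp (- potential m z)) •
      (starRingEnd ℂ) (fderiv ℂ (localExpr s i) z v) := by
  have h1 : DifferentiableAt ℝ (fun z : Fin n → ℂ => 2 * Real.exp (- potential m z)) z :=
    ((contDiff_potential m).differentiable (by simp)).neg.exp.const_mul 2 z
  have h2 : HasFDerivAt (fun z => (starRingEnd ℂ) (localExpr s i z)) _ z :=
    Complex.conjCLE.hasFDerivAt.comp z
      ((contDiff_real_localExpr s i).differentiable (by simp) z).hasFDerivAt
  have h3 : HasFDerivAt (conjWeight s i) _ z := h1.hasFDerivAt.fun_smul h2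
  rw [h3.fderiv]
  simp [hz, fderiv_real_localExpr]

theorem covDeriv_of_eq_zero (s : H0 n m) (i : Fin (n + 1)) {z : Fin n → ℂ}
    (hz : localExpr s i z = 0) : covDeriv s i z = fderiv ℂ (localExpr s i) z := by
  ext v; simp [covDeriv, hz]

theorem differentiable_covDeriv (s : H0 n m) (i : Fin (n + 1)) :
    Differentiable ℝ (covDeriv s i) := (contDiff_covDeriv s i).differentiable (by simp)

/-- Along the zeros of `s` the null space of the Hessian of `|s|²` is the kernel of `df`. -/
theorem hessian_normSq_of_eq_zero {s : H0 n m} {i : Fin (n + 1)} {z : Fin n → ℂ}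
    (hz : localExpr s i z = 0) (hd : covDeriv s i z ≠ 0) (v : Fin n → ℂ) :
    (∀ w, hessian (normSq s) i z v w = 0) ↔ fderiv ℂ (localExpr s i) z v = 0 := by
  simp only [hessian, fderiv_inChart_normSq,
    fderiv_reForm_smul (differentiable_conjWeight s i z) (differentiable_covDeriv s i z),
    reForm_apply, forall_re_eq_zero_iff, (conjWeight_eq_zero_iff s i z).2 hz,
    zero_smul_add_smul_eq_zero_iff _ _ hd, fderiv_conjWeight_of_eq_zero s i hz]
  simp

/-- In the product rule the derivative of the weight multiplies `∇s = 0`, leaving a nonzero weight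
times the derivative of `∇s`, which is injective by regularity. -/
theorem hessian_normSq_of_covDeriv_eq_zero {s : H0 n m} {i : Fin (n + 1)} {z : Fin n → ℂ}
    (hs : IsRegularOn s i) (hz : covDeriv s i z = 0) (v : Fin n → ℂ) :
    (∀ w, hessian (normSq s) i z v w = 0) ↔ v = 0 := by
  obtain ⟨h0, h1⟩ := hs z hz
  simp only [hessian, fderiv_inChart_normSq,
    fderiv_reForm_smul (differentiable_conjWeight s i z) (differentiable_covDeriv s i z),
    reForm_apply, forall_re_eq_zero_iff, hz,
    smul_add_smul_zero_eq_zero_iff (mt (conjWeight_eq_zero_iff s i z).1 h0)]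
  exact ⟨h1 v, fun h => by rw [h, map_zero]⟩

theorem normSq_affinePt_eq_zero_iff (s : H0 n m) (i : Fin (n + 1)) (z : Fin n → ℂ) :
    normSq s (affinePt i z) = 0 ↔ localExpr s i z = 0 := by
  simp [normSq_affinePt, Real.exp_ne_zero]

theorem hessian_log_normSq_of_covDeriv_eq_zero {s : H0 n m} {i : Fin (n + 1)} {z : Fin n → ℂ}
    (hs : IsRegularOn s i) (hz : covDeriv s i z = 0) {v : Fin n → ℂ}
    (hv : ∀ w, hessian (fun q => Real.log (normSq s q)) i z v w = 0) : v = 0 := by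
  obtain ⟨h0, h1⟩ := hs z hz
  have hne : ∀ x, localExpr s i x ≠ 0 → inChart (normSq s) i x ≠ 0 := fun x hx h =>
    hx ((normSq_affinePt_eq_zero_iff s i x).1 h)
  let g : (Fin n → ℂ) → ℂ := fun x => (inChart (normSq s) i x)⁻¹ • conjWeight s i x
  have hg0 : g z ≠ 0 :=
    smul_ne_zero (inv_ne_zero (hne z h0)) (mt (conjWeight_eq_zero_iff s i z).1 h0)
  have hg : DifferentiableAt ℝ g z :=
    (((contDiff_inChart_normSq s i).differentiable (by simp) z).inv (hne z h0)).fun_smul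
      (differentiable_conjWeight s i z)
  -- The formula `d log |s|² = Re (g ∇s)` is available only where `s ≠ 0`, an open condition at `z`;
  -- that suffices for the second derivative at `z`.
  have hev : fderiv ℝ (inChart (fun q => Real.log (normSq s q)) i) =ᶠ[𝓝 z]
      fun x => reForm (g x • covDeriv s i x) := by
    filter_upwards [(differentiable_localExpr s i).continuous.continuousAt.eventually_ne h0]
      with x hx
    have h2 : HasFDerivAt (inChart (fun q => Real.log (normSq s q)) i) _ x :=
      (hasFDerivAt_inChart_normSq s i x).log (hne x hx)
    rw [h2.fderiv]
    simp only [g, smul_assoc, map_smul]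
  simp only [hessian, hev.fderiv_eq, fderiv_reForm_smul hg (differentiable_covDeriv s i z),
    reForm_apply, forall_re_eq_zero_iff, hz, smul_add_smul_zero_eq_zero_iff hg0] at hv
  exact h1 v hv

end Hessian

/-! ### Local diffeomorphisms with a ball as target. -/

section Straightening

/-- A smooth map whose derivative at `z` is the identity restricts to a diffeomorphism from a small
neighbourhood of `z` onto a ball. -/
theorem exists_localDiffeo_onto_ball {E : Type*} [NormedAddCommGroup E] [NormedSpace ℝ E]
    [CompleteSpace E] {G : E → E} (hG : ContDiff ℝ ∞ G) {z : E}
    (hz : HasFDerivAt G (ContinuousLinearMap.id ℝ E) z) {U : Set E} (hU : U ∈ 𝓝 z) :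
    ∃ (Φ : OpenPartialHomeomorph E E) (r : ℝ), ⇑Φ = G ∧ z ∈ Φ.source ∧ Φ.source ⊆ U ∧
      Φ.target = Metric.ball (G z) r ∧ ContDiffOn ℝ ∞ Φ.symm Φ.target := by
  have hz' : HasFDerivAt G ((ContinuousLinearEquiv.refl ℝ E : E ≃L[ℝ] E) : E →L[ℝ] E) z := hz
  let Φ₀ := hG.contDiffAt.toOpenPartialHomeomorph G hz' (by simp)
  have hz₀ : z ∈ Φ₀.source := hG.contDiffAt.mem_toOpenPartialHomeomorph_source hz' (by simp)
  have hΦ₀ : ⇑Φ₀ = G := rfl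
  -- The derivative must be invertible on the whole source, not only at `z`, for the inverse to be
  -- smooth on the whole target.
  have hinv : ∀ᶠ x in 𝓝 z, fderiv ℝ G x ∈ Set.range ((↑) : (E ≃L[ℝ] E) → E →L[ℝ] E) := by
    refine (hG.continuous_fderiv (by simp)).continuousAt.eventually_mem
      (ContinuousLinearEquiv.isOpen.mem_nhds ?_)
    rw [hz'.fderiv]
    exact ⟨_, rfl⟩
  obtain ⟨O, hO, hOo, hzO⟩ := mem_nhds_iff.1 (Filter.inter_mem hU hinv)
  let Φ₁ := Φ₀.restrOpen O hOo
  have hz₁ : z ∈ Φ₁.source := ⟨hz₀, hzO⟩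
  obtain ⟨r, hr, hball⟩ := Metric.isOpen_iff.1 Φ₁.open_target (G z) (Φ₁.map_source hz₁)
  let Φ := (Φ₁.symm.restrOpen (Metric.ball (G z) r) Metric.isOpen_ball).symm
  have hsrc : Φ.source ⊆ Φ₁.source := by
    intro x hx
    have h1 := Φ.map_source hx
    have h2 : Φ.symm (Φ x) = x := Φ.left_inv hx
    rw [← h2]
    exact Φ₁.map_target (hball h1.2)
  have hzt : G z ∈ Φ.target := ⟨Φ₁.map_source hz₁, Metric.mem_ball_self hr⟩
  have hzs : z ∈ Φ.source := by
    have h1 := Φ.map_target hzt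
    have h2 : Φ.symm (G z) = z := Φ₁.left_inv hz₁
    rwa [h2] at h1
  refine ⟨Φ, r, rfl, hzs, fun x hx => (hO (hsrc hx).2).1, ?_, fun y hy => ?_⟩
  · exact Set.inter_eq_right.2 hball
  · obtain ⟨e, he⟩ := (hO (hsrc (Φ.map_target hy)).2).2
    refine (Φ.contDiffAt_symm hy (f₀' := e) ?_ hG.contDiffAt).contDiffWithinAt
    rw [he]
    exact (hG.differentiable (by simp) _).hasFDerivAt

end Straightening

/-! ### Structure of the critical set of a regular section. -/

section CriticalSet

variable {n m : ℕ}

theorem isCriticalPoint_affinePt {s : H0 n m} {i : Fin (n + 1)} {z : Fin n → ℂ}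
    (h : IsCriticalPoint s (affinePt i z)) : covDeriv s i z = 0 := by
  ext v
  rw [← nabla_eq_covDeriv]
  exact h i z rfl v

/-- An injective linear map in finite dimension is bounded below, so a zero with injective
derivative is isolated. -/
theorem eventually_covDeriv_ne_zero {s : H0 n m} {i : Fin (n + 1)} {z : Fin n → ℂ}
    (hs : IsRegularOn s i) (hz : covDeriv s i z = 0) :
    ∀ᶠ x in 𝓝[≠] z, covDeriv s i x ≠ 0 := by
  refine (differentiable_covDeriv s i z).hasFDerivAt.eventually_ne ?_
  obtain ⟨K, -, hK⟩ := LinearMap.exists_antilipschitzWith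
    (fderiv ℝ (covDeriv s i) z).toLinearMap
    (LinearMap.ker_eq_bot'.2 fun v hv => (hs z hz).2 v hv)
  exact ⟨K, hK⟩

theorem isIsolatedCritical_of_isRegularOn {s : H0 n m} (hs : ∀ i, IsRegularOn s i) {p : CP n}
    (hp : IsCriticalPoint s p) : IsIsolatedCritical s p := by
  obtain ⟨i, z, rfl⟩ := exists_affinePt_eq p
  have hz := isCriticalPoint_affinePt hp
  have h1 := eventually_nhdsWithin_iff.1 (eventually_covDeriv_ne_zero (hs i) hz)
  refine ⟨_, (isOpenMap_affinePt i).image_mem_nhds h1, ?_⟩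
  rintro _ ⟨x, hx, rfl⟩ hq
  by_contra hne
  exact hx (fun h => hne (by rw [h])) (isCriticalPoint_affinePt hq)

theorem isNondegenerateCritical_of_isRegularOn {s : H0 n m} (hs : ∀ i, IsRegularOn s i) {p : CP n}
    (hp : IsCriticalPoint s p) : IsNondegenerateCritical s p := by
  refine ⟨hp, ?_, ?_⟩
  · obtain ⟨i, z, rfl⟩ := exists_affinePt_eq p
    rw [Ne, normSq_affinePt_eq_zero_iff]
    exact (hs i z (isCriticalPoint_affinePt hp)).1
  · rintro i z rfl v hv
    exact hessian_log_normSq_of_covDeriv_eq_zero (hs i) (isCriticalPoint_affinePt hp) hv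

theorem eq_zero_or_of_mem_critSet {s : H0 n m} {i : Fin (n + 1)} {z : Fin n → ℂ}
    (h : affinePt i z ∈ critSet (normSq s)) : localExpr s i z = 0 ∨ covDeriv s i z = 0 :=
  (fderiv_inChart_normSq_eq_zero_iff s i z).1 (h i z rfl)

/-- Membership in `critSet` concerns every chart; vanishing of `s` passes between charts because it
is vanishing of the global function `|s|²`. -/
theorem mem_critSet_of_eq_zero {s : H0 n m} {i : Fin (n + 1)} {z : Fin n → ℂ}
    (h : localExpr s i z = 0) : affinePt i z ∈ critSet (normSq s) := by
  intro j w hw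
  rw [fderiv_inChart_normSq_eq_zero_iff]
  left
  rwa [← normSq_affinePt_eq_zero_iff, hw, normSq_affinePt_eq_zero_iff]

/-- Near each of its points the critical set of `|s|²` is straightened by a diffeomorphism onto a
ball, and its tangent space is the null space of the Hessian. -/
theorem exists_straightening_critSet {s : H0 n m} (hs : ∀ i, IsRegularOn s i) {i : Fin (n + 1)}
    {z : Fin n → ℂ} (hz : affinePt i z ∈ critSet (normSq s)) :
    ∃ (Φ : OpenPartialHomeomorph (Fin n → ℂ) (Fin n → ℂ)) (W : Submodule ℝ (Fin n → ℂ))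
      (c : Fin n → ℂ) (r : ℝ), z ∈ Φ.source ∧ ContDiffOn ℝ ∞ Φ Φ.source ∧
      ContDiffOn ℝ ∞ Φ.symm Φ.target ∧ Φ.target = Metric.ball c r ∧
      (∀ x ∈ Φ.source, affinePt i x ∈ critSet (normSq s) ↔ Φ x ∈ W) ∧
      ∀ v, (∀ w, hessian (normSq s) i z v w = 0) ↔ v ∈ W.comap (fderiv ℝ Φ z).toLinearMap := by
  by_cases h0 : localExpr s i z = 0
  · have hd : covDeriv s i z ≠ 0 := fun h => (hs i z h).1 h0
    have hU : ∀ᶠ x in 𝓝 z, covDeriv s i x ≠ 0 :=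
      (differentiable_covDeriv s i).continuous.continuousAt.eventually_ne hd
    set ℓ := fderiv ℂ (localExpr s i) z with hℓ
    obtain ⟨u, hu⟩ : ∃ u, ℓ u = 1 := by
      obtain ⟨u, hu⟩ : ∃ u, ℓ u ≠ 0 := by
        by_contra! h
        exact hd ((covDeriv_of_eq_zero s i h0).trans (ContinuousLinearMap.ext h))
      exact ⟨(ℓ u)⁻¹ • u, by simp [hu]⟩
    -- Replaces the component along `u` by `f` itself: `ℓ (G x) = f x` exactly, so `G` takes the
    -- zeros of `f` into `ker ℓ`, and `dG = id` at `z`.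
    let G : (Fin n → ℂ) → (Fin n → ℂ) := fun x => x + (localExpr s i x - ℓ x) • u
    have hG : ContDiff ℝ ∞ G := contDiff_id.add
      (((contDiff_real_localExpr s i).sub (ℓ.restrictScalars ℝ).contDiff).smul contDiff_const)
    have hGz : HasFDerivAt G (ContinuousLinearMap.id ℝ (Fin n → ℂ)) z := by
      have h1 : HasFDerivAt (localExpr s i) (ℓ.restrictScalars ℝ) z :=
        (differentiable_localExpr s i z).hasFDerivAt.restrictScalars ℝ
      have h2 := (hasFDerivAt_id (𝕜 := ℝ) z).add
        ((h1.fun_sub (ℓ.restrictScalars ℝ).hasFDerivAt).smul_const u)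
      refine h2.congr_fderiv ?_
      ext v
      simp
    have hℓG : ∀ x, ℓ (G x) = localExpr s i x := fun x => by simp [G, hu]
    obtain ⟨Φ, r, hΦ, hzs, hsU, ht, hsymm⟩ := exists_localDiffeo_onto_ball hG hGz hU
    refine ⟨Φ, LinearMap.ker (ℓ.restrictScalars ℝ).toLinearMap, G z, r, hzs, ?_, hsymm, ht,
      fun x hx => ?_, fun v => ?_⟩
    · rw [hΦ]; exact hG.contDiffOn
    · have h1 : Φ x ∈ LinearMap.ker (ℓ.restrictScalars ℝ).toLinearMap ↔ ℓ (G x) = 0 := by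
        rw [hΦ]; rfl
      rw [h1, hℓG]
      exact ⟨fun h => (eq_zero_or_of_mem_critSet h).resolve_right (hsU hx),
        mem_critSet_of_eq_zero⟩
    · rw [hessian_normSq_of_eq_zero h0 hd, hΦ, hGz.fderiv]
      rfl
  · have hc : covDeriv s i z = 0 := (eq_zero_or_of_mem_critSet hz).resolve_left h0
    have hU : ∀ᶠ x in 𝓝 z, localExpr s i x ≠ 0 ∧ (x ≠ z → covDeriv s i x ≠ 0) :=
      ((differentiable_localExpr s i).continuous.continuousAt.eventually_ne h0).and
        (eventually_nhdsWithin_iff.1 (eventually_covDeriv_ne_zero (hs i) hc))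
    -- Here the critical set is locally the single point `z`, so a translation straightens it to the
    -- zero subspace.
    have hG : ContDiff ℝ ∞ fun x : Fin n → ℂ => x - z := contDiff_id.sub contDiff_const
    have hGz : HasFDerivAt (fun x : Fin n → ℂ => x - z) (ContinuousLinearMap.id ℝ (Fin n → ℂ)) z :=
      (hasFDerivAt_id z).sub_const z
    obtain ⟨Φ, r, hΦ, hzs, hsU, ht, hsymm⟩ := exists_localDiffeo_onto_ball hG hGz hU
    refine ⟨Φ, ⊥, z - z, r, hzs, ?_, hsymm, ht, fun x hx => ?_, fun v => ?_⟩
    · rw [hΦ]; exact hG.contDiffOn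
    · rw [hΦ, Submodule.mem_bot, sub_eq_zero]
      refine ⟨fun h => ?_, fun h => h ▸ hz⟩
      by_contra hne
      exact (eq_zero_or_of_mem_critSet h).elim (hsU hx).1 ((hsU hx).2 hne)
    · rw [hessian_normSq_of_covDeriv_eq_zero (hs i) hc, hΦ, hGz.fderiv]
      rfl

/-- The straightening describes the whole critical set, whereas a submanifold chart is needed for
one connected component. The target being a ball, its intersection with `W` is convex; so the local
piece of the critical set is connected and lies in the component of `z`. -/
theorem isGeneralizedMorse_of_isRegularOn {s : H0 n m} (hs : ∀ i, IsRegularOn s i) :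
    IsGeneralizedMorse (normSq s) := by
  refine ⟨contDiff_inChart_normSq s, fun p hp =>
    ⟨isConnected_connectedComponentIn_iff.2 hp, connectedComponentIn_subset _ _, ?_⟩⟩
  intro i z hz
  obtain ⟨Φ, W, c, r, hzs, hΦ, hsymm, ht, hW, hH⟩ :=
    exists_straightening_critSet hs (connectedComponentIn_subset _ _ hz)
  refine ⟨W.comap (fderiv ℝ Φ z).toLinearMap,
    ⟨Φ, W, hz, hzs, hΦ, hsymm, fun x hx => ⟨fun h => ?_, fun h => ?_⟩, rfl⟩, hH⟩
  · exact (hW x hx).1 (connectedComponentIn_subset _ _ h)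
  · have hpre : IsPreconnected (Φ.target ∩ W) := by
      rw [ht]
      exact ((convex_ball c r).inter W.convex).isPreconnected
    have hpre' : IsPreconnected (affinePt i '' (Φ.symm '' (Φ.target ∩ W))) :=
      (hpre.image _ (Φ.continuousOn_symm.mono Set.inter_subset_left)).image _
        (continuous_affinePt i).continuousOn
    have hsub : affinePt i '' (Φ.symm '' (Φ.target ∩ W)) ⊆ critSet (normSq s) := by
      rintro _ ⟨_, ⟨y, ⟨hy, hyW⟩, rfl⟩, rfl⟩
      rw [hW _ (Φ.map_target hy), Φ.right_inv hy]
      exact hyW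
    have hmem : ∀ y ∈ Φ.source, Φ y ∈ W → affinePt i y ∈
        affinePt i '' (Φ.symm '' (Φ.target ∩ W)) := fun y hy hyW =>
      ⟨y, ⟨Φ y, ⟨Φ.map_source hy, hyW⟩, Φ.left_inv hy⟩, rfl⟩
    have hzW : Φ z ∈ W := (hW z hzs).1 (connectedComponentIn_subset _ _ hz)
    change affinePt i x ∈ connectedComponentIn (critSet (normSq s)) p
    rw [connectedComponentIn_eq hz]
    exact hpre'.subset_connectedComponentIn (hmem z hzs hzW) hsub (hmem x hx h)

end CriticalSet

end FubiniStudy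

theorem theorem1p4 (n m : ℕ) (hm : 1 ≤ m) :
    ∃ S : Set (FubiniStudy.H0 n m), FubiniStudy.IsLebesgueNull S ∧
      ∀ s : FubiniStudy.H0 n m, s ∉ S →
        (∀ p : FubiniStudy.CP n, FubiniStudy.IsCriticalPoint s p →
          FubiniStudy.IsNondegenerateCritical s p ∧ FubiniStudy.IsIsolatedCritical s p) ∧
        FubiniStudy.IsGeneralizedMorse (FubiniStudy.normSq s) := by
  -- The `n + 1` charts cover projective space, so a finite union of null sets suffices.
  refine ⟨⋃ i, {s | ¬ FubiniStudy.IsRegularOn s i}, ?_, fun s hs => ?_⟩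
  · rw [FubiniStudy.IsLebesgueNull, Set.image_iUnion]
    exact MeasureTheory.measure_iUnion_null fun i =>
      FubiniStudy.isLebesgueNull_not_isRegularOn hm i
  · have hreg : ∀ i, FubiniStudy.IsRegularOn s i := by simpa using hs
    exact ⟨fun p hp => ⟨FubiniStudy.isNondegenerateCritical_of_isRegularOn hreg hp,
      FubiniStudy.isIsolatedCritical_of_isRegularOn hreg hp⟩,
      FubiniStudy.isGeneralizedMorse_of_isRegularOn hreg⟩
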